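/- Let $D$ be a division ring with center $F$, and let $n\geq 2$ be an integer such that either (i) $F$ has at least three elements (possibly infinitely many), or (ii) $F$ has exactly two elements and $n$ is odd. In a ring $R$, a commutator is an element of the form $ab-ba$ with $a,b\in R$; it is called noncentral if it does not belong to the center of $R$. Suppose that every nonzero element of $D$ is a product $yz$ of two noncentral commutators $y,z$ in $D$. Then every matrix $A\in \mathrm{M}_n(D)$ is a product $A=BC$ of two commutators $B,C$ in the ring $\mathrm{M}_n(D)$. -/

import Mathlib

/-- An element of a ring is an (additive) commutator if it has the form `a * b - b * a`. -/
def IsAdditiveCommutator {R : Type*} [Ring R] (x : R) : Prop :=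
  ∃ a b : R, x = a * b - b * a

/-- A noncentral commutator: a commutator that does not belong to the center of the ring. -/
def IsNoncentralCommutator {R : Type*} [Ring R] (x : R) : Prop :=
  IsAdditiveCommutator x ∧ x ∉ Subring.center R

open Matrix

/-! Being a product of two commutators is invariant under conjugation. A scalar matrix `a • 1` is
settled by factoring `a` in `D`. A nonscalar matrix is conjugated so that its leading entry is a
chosen pivot, then factored as block lower times block upper triangular, and the Schur complement is
treated recursively (`exists_isConj_lower_mul_upper`). Each factor must become a commutator, so the
induction tracks a defect: the amount `s` to add to one diagonal entry to make it one. A new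
diagonal entry `b` turns defect `s + b` into `s`. The freedom to split a pivot as `b * c` keeps both
defects nonzero until the Schur complement is scalar, where they are cancelled; this needs some `x ≠
0, 1` in `D`. -/

theorem IsConj.mul_left_conj {R : Type*} [Ring R] {x y g g' : R} (h₁ : g * g' = 1) (h₂ : g' * g = 1)
    (h : g * x * g' = y) : IsConj x y :=
  ⟨⟨g, g', h₁, h₂⟩, by
    change g * x = y * g
    rw [← h, mul_assoc (g * x), h₂, mul_one]⟩

theorem IsAdditiveCommutator.of_isConj {R : Type*} [Ring R] (c : Rˣ) {x : R}
    (hx : IsAdditiveCommutator x) : IsAdditiveCommutator (↑c⁻¹ * x * ↑c : R) := by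
  obtain ⟨a, b, rfl⟩ := hx
  refine ⟨↑c⁻¹ * a * ↑c, ↑c⁻¹ * b * ↑c, ?_⟩
  simp [mul_assoc, mul_sub, sub_mul]

/-- Being a product of two additive commutators. -/
def IsCommutatorProduct {R : Type*} [Ring R] (x : R) : Prop :=
  ∃ y z : R, IsAdditiveCommutator y ∧ IsAdditiveCommutator z ∧ x = y * z

theorem IsCommutatorProduct.of_isConj {R : Type*} [Ring R] {x y : R} (h : IsConj x y)
    (hy : IsCommutatorProduct y) : IsCommutatorProduct x := by
  obtain ⟨c, hc⟩ := h
  obtain ⟨p, q, hp, hq, rfl⟩ := hy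
  refine ⟨_, _, hp.of_isConj c, hq.of_isConj c, ?_⟩
  have hc' : (c : R) * x = p * q * c := hc
  calc x = ↑c⁻¹ * (↑c * x) := by simp
    _ = _ := by rw [hc']; simp [mul_assoc]

theorem IsCommutatorProduct.map {R S : Type*} [Ring R] [Ring S] (f : R →+* S) {x : R}
    (hx : IsCommutatorProduct x) : IsCommutatorProduct (f x) := by
  obtain ⟨_, _, ⟨a, b, rfl⟩, ⟨c, d, rfl⟩, rfl⟩ := hx
  exact ⟨_, _, ⟨f a, f b, rfl⟩, ⟨f c, f d, rfl⟩, by simp⟩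

section Blocks

/-! ### Triangular blocks that are commutators up to a diagonal defect. -/

variable {D : Type*} [DivisionRing D] {ι κ : Type*} [Fintype ι] [DecidableEq ι]
  [Fintype κ] [DecidableEq κ]

/-- `M` becomes a commutator `P * Q - Q * P` once `s` is added to some diagonal entry `i`, where `P`
has zero `i`-th row and the columns of `P` together with the `i`-th basis vector span. -/
def IsLowerCommutator (M : Matrix ι ι D) (s : D) : Prop :=
  ∃ (i : ι) (P Q : Matrix ι ι D), M + single i i s = P * Q - Q * P ∧ (∀ j, P i j = 0) ∧
    ∀ l : ι → D, ∃ (q : D) (v : ι → D), Pi.single i q + P *ᵥ v = l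

/-- The analogue of `IsLowerCommutator` with rows and columns exchanged. -/
def IsUpperCommutator (M : Matrix ι ι D) (s : D) : Prop :=
  ∃ (i : ι) (P Q : Matrix ι ι D), M + single i i s = P * Q - Q * P ∧ (∀ j, P j i = 0) ∧
    ∀ l : ι → D, ∃ (q : D) (v : ι → D), Pi.single i q + v ᵥ* P = l

theorem IsLowerCommutator.isAdditiveCommutator {M : Matrix ι ι D} (h : IsLowerCommutator M 0) :
    IsAdditiveCommutator M := by
  obtain ⟨i, P, Q, h, -⟩ := h
  exact ⟨P, Q, by simpa using h⟩

theorem IsUpperCommutator.isAdditiveCommutator {M : Matrix ι ι D} (h : IsUpperCommutator M 0) :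
    IsAdditiveCommutator M := by
  obtain ⟨i, P, Q, h, -⟩ := h
  exact ⟨P, Q, by simpa using h⟩

theorem IsLowerCommutator.submatrix {M : Matrix ι ι D} {s : D} (h : IsLowerCommutator M s)
    (e : κ ≃ ι) : IsLowerCommutator (M.submatrix e e) s := by
  obtain ⟨i, P, Q, h, h0, hs⟩ := h
  refine ⟨e.symm i, P.submatrix e e, Q.submatrix e e, ?_, fun j => by simp [h0], fun l => ?_⟩
  · rw [submatrix_mul_equiv, submatrix_mul_equiv]
    ext a b
    have := congrFun (congrFun h (e a)) (e b)
    simpa [single_apply, Equiv.symm_apply_eq] using this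
  · obtain ⟨q, v, hv⟩ := hs (l ∘ e.symm)
    refine ⟨q, v ∘ e, ?_⟩
    rw [submatrix_mulVec_equiv]
    ext a
    have := congrFun hv (e a)
    simpa [Pi.single_apply, Equiv.eq_symm_apply, Function.comp_assoc] using this

theorem IsUpperCommutator.submatrix {M : Matrix ι ι D} {s : D} (h : IsUpperCommutator M s)
    (e : κ ≃ ι) : IsUpperCommutator (M.submatrix e e) s := by
  obtain ⟨i, P, Q, h, h0, hs⟩ := h
  refine ⟨e.symm i, P.submatrix e e, Q.submatrix e e, ?_, fun j => by simp [h0], fun l => ?_⟩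
  · rw [submatrix_mul_equiv, submatrix_mul_equiv]
    ext a b
    have := congrFun (congrFun h (e a)) (e b)
    simpa [single_apply, Equiv.symm_apply_eq] using this
  · obtain ⟨q, v, hv⟩ := hs (l ∘ e.symm)
    refine ⟨q, v ∘ e, ?_⟩
    rw [submatrix_vecMul_equiv]
    ext a
    have := congrFun hv (e a)
    simpa [Pi.single_apply, Equiv.eq_symm_apply, Function.comp_assoc] using this

theorem IsLowerCommutator.fromBlocks {M : Matrix κ κ D} {s b : D} (h : IsLowerCommutator M (s + b))
    (l : κ → D) :
    IsLowerCommutator (fromBlocks (of fun _ _ : Unit => b) 0 (of fun i _ => l i) M) s := by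
  obtain ⟨k, P, Q, h, h0, hs⟩ := h
  -- The spanning condition makes the prescribed column `l` attainable; `q` and `v` form the first
  -- column of the new `Q`.
  obtain ⟨q, v, hv⟩ := hs (fun i => l i + Q i k)
  refine ⟨Sum.inl (), Matrix.fromBlocks 0 0 (of fun i _ => if i = k then 1 else 0) P,
    Matrix.fromBlocks (of fun _ _ => q) (of fun _ j => if j = k then -(s + b) else 0)
      (of fun i _ => v i) Q, ?_, ?_, ?_⟩
  · ext (i | i) (j | j)
    · simp [fromBlocks_multiply, mul_apply, add_comm]
    · simp [fromBlocks_multiply, mul_apply, h0]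
    · have := congrFun hv i
      simp only [Pi.add_apply, Pi.single_apply, mulVec, dotProduct] at this
      simp [fromBlocks_multiply, mul_apply]
      rw [this]; abel
    · have hM : M i j = (P * Q) i j - (Q * P) i j - single k k (s + b) i j := by
        rw [← Matrix.sub_apply, ← h]; simp
      simp [fromBlocks_multiply, hM, mul_apply, single_apply]
      by_cases hi : i = k <;> by_cases hj : j = k <;> simp [hi, hj, eq_comm (a := k)]; abel
  · rintro (j | j) <;> simp
  · intro l
    obtain ⟨q, v, hv⟩ := hs (fun i => l (Sum.inr i))
    refine ⟨l (Sum.inl ()), Sum.elim (fun _ => q) v, ?_⟩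
    ext (i | i)
    · simp [fromBlocks_mulVec]
    · have := congrFun hv i
      simp only [Pi.add_apply, Pi.single_apply] at this
      simp [fromBlocks_mulVec, mulVec, dotProduct] at this ⊢
      exact this

theorem IsUpperCommutator.fromBlocks {M : Matrix κ κ D} {s b : D} (h : IsUpperCommutator M (s + b))
    (l : κ → D) :
    IsUpperCommutator (fromBlocks (of fun _ _ : Unit => b) (of fun _ i => l i) 0 M) s := by
  obtain ⟨k, P, Q, h, h0, hs⟩ := h
  obtain ⟨q, v, hv⟩ := hs (fun i => Q k i - l i)
  refine ⟨Sum.inl (), Matrix.fromBlocks 0 (of fun _ i => if i = k then 1 else 0) 0 P,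
    Matrix.fromBlocks (of fun _ _ => q) (of fun _ j => v j)
      (of fun i _ => if i = k then s + b else 0) Q, ?_, ?_, ?_⟩
  · ext (i | i) (j | j)
    · simp [fromBlocks_multiply, mul_apply, add_comm]
    · have := congrFun hv j
      simp only [Pi.add_apply, Pi.single_apply, vecMul, dotProduct] at this
      simp [fromBlocks_multiply, mul_apply]
      rw [this]; abel
    · simp [fromBlocks_multiply, mul_apply, h0]
    · have hM : M i j = (P * Q) i j - (Q * P) i j - single k k (s + b) i j := by
        rw [← Matrix.sub_apply, ← h]; simp
      simp [fromBlocks_multiply, hM, mul_apply, single_apply]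
      by_cases hi : i = k <;> by_cases hj : j = k <;> simp [hi, hj, eq_comm (a := k)]; abel
  · rintro (j | j) <;> simp
  · intro l
    obtain ⟨q, v, hv⟩ := hs (fun i => l (Sum.inr i))
    refine ⟨l (Sum.inl ()), Sum.elim (fun _ => q) v, ?_⟩
    ext (i | i)
    · simp [vecMul_fromBlocks]
    · have := congrFun hv i
      simp only [Pi.add_apply, Pi.single_apply] at this
      simp [vecMul_fromBlocks, vecMul, dotProduct] at this ⊢
      exact this

theorem isLowerCommutator_fromBlocks_diagonal {a : D} (ha : a ≠ 0) (b s : D) (l : κ → D) :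
    IsLowerCommutator (fromBlocks (of fun _ _ : Unit => -s) 0 (of fun i _ => l i)
      (diagonal fun _ => a * b - b * a)) s := by
  refine ⟨Sum.inl (), Matrix.fromBlocks 0 0 0 (diagonal fun _ => a),
    Matrix.fromBlocks 0 0 (of fun i _ => a⁻¹ * l i) (diagonal fun _ => b), ?_, ?_, fun l => ?_⟩
  · ext (i | i) (j | j) <;> simp [fromBlocks_multiply, ha, diagonal_apply, ite_sub_ite]
  · rintro (j | j) <;> simp
  · refine ⟨l (Sum.inl ()), fun i => a⁻¹ * l i, ?_⟩
    ext (i | i) <;> simp [fromBlocks_mulVec, ha]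

theorem isUpperCommutator_fromBlocks_diagonal {a : D} (ha : a ≠ 0) (b s : D) (l : κ → D) :
    IsUpperCommutator (fromBlocks (of fun _ _ : Unit => -s) (of fun _ i => l i) 0
      (diagonal fun _ => a * b - b * a)) s := by
  refine ⟨Sum.inl (), Matrix.fromBlocks 0 0 0 (diagonal fun _ => a),
    Matrix.fromBlocks 0 (of fun _ i => -l i * a⁻¹) 0 (diagonal fun _ => b), ?_, ?_, fun l => ?_⟩
  · ext (i | i) (j | j) <;> simp [fromBlocks_multiply, ha, diagonal_apply, ite_sub_ite]
  · rintro (j | j) <;> simp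
  · refine ⟨l (Sum.inl ()), fun i => l i * a⁻¹, ?_⟩
    ext (i | i) <;> simp [vecMul_fromBlocks, ha]

/-! ### Conjugating to a prescribed leading entry. -/

theorem IsConj.submatrix {S T : Matrix ι ι D} (h : IsConj S T) (e : κ ≃ ι) :
    IsConj (S.submatrix e e) (T.submatrix e e) :=
  MonoidHom.map_isConj (reindexAlgEquiv ℕ D e.symm).toRingEquiv.toRingHom.toMonoidHom h

theorem IsCommutatorProduct.submatrix {S : Matrix ι ι D} (h : IsCommutatorProduct S) (e : κ ≃ ι) :
    IsCommutatorProduct (S.submatrix e e) :=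
  h.map (reindexAlgEquiv ℕ D e.symm).toRingEquiv.toRingHom

theorem exists_isConj_submatrix_fromBlocks_of_apply_ne_zero {ι : Type} [Fintype ι] [DecidableEq ι]
    (S : Matrix ι ι D) {i₀ j₀ : ι} (hij : j₀ ≠ i₀) (hS : S j₀ i₀ ≠ 0) (h : D) :
    ∃ (κ : Type) (_ : Fintype κ) (_ : DecidableEq κ) (e : Unit ⊕ κ ≃ ι) (k : κ)
      (r : Matrix Unit κ D) (A : Matrix κ κ D), IsConj (S.submatrix e e)
        (fromBlocks (of fun _ _ => h) r (of fun i _ => if i = k then 1 else 0) A) := by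
  let e : Unit ⊕ {j // j ≠ i₀} ≃ ι :=
    (Equiv.sumCongr (Equiv.ofUnique Unit {j // j = i₀}) (Equiv.refl _)).trans
      (Equiv.sumCompl fun j => j = i₀)
  let k : {j // j ≠ i₀} := ⟨j₀, hij⟩
  let c : {j // j ≠ i₀} → D := fun j => S j i₀
  have hc : c k ≠ 0 := hS
  let T := S.submatrix e e
  have hT : T = fromBlocks (of fun _ _ => S i₀ i₀) T.toBlocks₁₂ (of fun i _ => c i) T.toBlocks₂₂ :=
    (fromBlocks_toBlocks T).symm
  -- `X` is a rank-one perturbation of `1` mapping the column `c` to the `k`-th basis vector.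
  let v : {j // j ≠ i₀} → D := fun i => c i - if i = k then 1 else 0
  have hv : v k = c k - 1 := by simp [v]
  let X : Matrix {j // j ≠ i₀} {j // j ≠ i₀} D := 1 - of fun i j => if j = k then v i * (c k)⁻¹ else 0
  let X' : Matrix {j // j ≠ i₀} {j // j ≠ i₀} D := 1 + of fun i j => if j = k then v i else 0
  have hX : X * X' = 1 := by
    rw [mul_add, mul_one, sub_mul, one_mul]
    ext i j
    by_cases hj : j = k
    · subst hj; simp [X, mul_apply, hv, mul_sub, mul_assoc, hc]
    · simp [X, mul_apply, hj]
  have hX' : X' * X = 1 := by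
    rw [mul_sub, add_mul, one_mul, mul_one, add_mul, one_mul, add_sub_assoc, add_eq_left]
    ext i j
    by_cases hj : j = k <;> simp [mul_apply, hj, hv, mul_sub, sub_mul, hc]
  have hXc : X * (of fun i _ => c i : Matrix _ Unit D) = of fun i _ => if i = k then 1 else 0 := by
    rw [Matrix.sub_mul, Matrix.one_mul]
    ext i j
    simp [mul_apply, hc, v, mul_assoc]
  -- Once the column is a basis vector, adding a multiple of row `k` to the first row moves the
  -- leading entry to `h`; the inverse factor on the right leaves the first column alone.
  let w : Matrix Unit {j // j ≠ i₀} D := of fun _ j => if j = k then h - S i₀ i₀ else 0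
  have hw : w * (of fun i _ => if i = k then 1 else 0 : Matrix _ Unit D)
      = of fun _ _ => h - S i₀ i₀ := by
    ext i j
    simp [w, mul_apply]
  refine ⟨_, inferInstance, inferInstance, e, k,
    -((of fun _ _ => h : Matrix Unit Unit D) * w) + (T.toBlocks₁₂ + w * (X * T.toBlocks₂₂)) * X',
    -((of fun i _ => if i = k then 1 else 0 : Matrix _ Unit D) * w) + X * T.toBlocks₂₂ * X',
    IsConj.mul_left_conj (g := fromBlocks 1 (w * X) 0 X) (g' := fromBlocks 1 (-w) 0 X') ?_ ?_ ?_⟩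
  · simp [fromBlocks_multiply, hX, Matrix.mul_assoc]
  · simp [fromBlocks_multiply, hX']
  · change _ * T * _ = _
    rw [hT]
    simp only [fromBlocks_multiply, Matrix.mul_zero, Matrix.zero_mul, Matrix.one_mul, Matrix.mul_one,
      add_zero, zero_add, Matrix.mul_assoc, hXc, hw, toBlocks_fromBlocks₁₂, toBlocks_fromBlocks₂₂]
    congr 1
    · ext; simp
    · rw [show (of fun _ _ => S i₀ i₀ : Matrix Unit Unit D) + (of fun _ _ => h - S i₀ i₀) =
        of fun _ _ => h by ext; simp]
      simp
    · simp

theorem exists_isConj_submatrix_fromBlocks {ι : Type} [Fintype ι] [DecidableEq ι]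
    (S : Matrix ι ι D) (hS : ¬ ∃ a, S = diagonal fun _ => a) (h : D) :
    ∃ (κ : Type) (_ : Fintype κ) (_ : DecidableEq κ) (e : Unit ⊕ κ ≃ ι) (k : κ)
      (r : Matrix Unit κ D) (A : Matrix κ κ D), IsConj (S.submatrix e e)
        (fromBlocks (of fun _ _ => h) r (of fun i _ => if i = k then 1 else 0) A) := by
  by_cases hd : ∃ i j, j ≠ i ∧ S j i ≠ 0
  · obtain ⟨i, j, hij, hS⟩ := hd
    exact exists_isConj_submatrix_fromBlocks_of_apply_ne_zero S hij hS h
  · push Not at hd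
    obtain ⟨i, j, hij⟩ : ∃ i j, S i i ≠ S j j := by
      by_contra! hc
      rcases isEmpty_or_nonempty ι with hι | ⟨⟨i⟩⟩
      · exact hS ⟨0, Subsingleton.elim _ _⟩
      · refine hS ⟨S i i, ?_⟩
        ext a b
        by_cases hab : a = b
        · subst hab; simp [hc a i]
        · simp [hab, hd b a hab]
    have hne : j ≠ i := by rintro rfl; exact hij rfl
    -- For diagonal `S`, conjugating by a transvection creates the off-diagonal entry `S j j - S i
    -- i`.
    have hE : single i j (1 : D) * single i j 1 = 0 := single_mul_single_of_ne _ _ _ _ hne _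
    have hconj : IsConj S ((1 + single i j 1) * S * (1 - single i j 1)) :=
      .mul_left_conj (by simp [mul_sub, add_mul, hE]) (by simp [sub_mul, mul_add, hE]) rfl
    obtain ⟨κ, _, _, e, k, r, A, hA⟩ := exists_isConj_submatrix_fromBlocks_of_apply_ne_zero
      ((1 + single i j 1) * S * (1 - single i j 1)) (i₀ := j) (j₀ := i) hne.symm (by
        simp [mul_sub, add_mul, hd j i hne.symm, hd i j hne, sub_eq_zero, hij.symm]) h
    exact ⟨κ, _, _, e, k, r, A, (hconj.submatrix e).trans hA⟩

/-- Block LU factorization with pivot `b * c`: the conjugation factoring the Schur complement is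
extended by `1` on the leading entry. -/
theorem fromBlocks_isConj_mul {b c : D} (hb : b ≠ 0) (hc : c ≠ 0) (r : Matrix Unit κ D)
    (l : Matrix κ Unit D) (A B C : Matrix κ κ D)
    (hS : IsConj (A - l * (of fun _ _ => (b * c)⁻¹ : Matrix Unit Unit D) * r) (B * C)) :
    ∃ (l' r' : κ → D), IsConj (fromBlocks (of fun _ _ => b * c) r l A)
      (fromBlocks (of fun _ _ => b) 0 (of fun i _ => l' i) B *
        fromBlocks (of fun _ _ => c) (of fun _ i => r' i) 0 C) := by
  obtain ⟨⟨g, g', hgg', hg'g⟩, hS⟩ := hS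
  have hg : g * A * g' =
      B * C + g * l * (of fun _ _ => (b * c)⁻¹ : Matrix Unit Unit D) * r * g' := by
    have h1 : g * (A - l * (of fun _ _ => (b * c)⁻¹ : Matrix Unit Unit D) * r)
      = B * C * g := hS
    have h2 : B * C = (B * C * g) * g' := by simp [Matrix.mul_assoc, hgg']
    rw [h2, ← h1]
    simp only [Matrix.mul_sub, Matrix.sub_mul, Matrix.mul_assoc]
    abel
  refine ⟨fun i => (g * l * (of fun _ _ => c⁻¹ : Matrix Unit Unit D)) i (),
    fun i => ((of fun _ _ => b⁻¹ : Matrix Unit Unit D) * r * g') () i,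
    IsConj.mul_left_conj (g := fromBlocks 1 0 0 g) (g' := fromBlocks 1 0 0 g') ?_ ?_ ?_⟩
  · simp [fromBlocks_multiply, hgg']
  · simp [fromBlocks_multiply, hg'g]
  have e1 : (of fun i _ => (g * l * (of fun _ _ => c⁻¹ : Matrix Unit Unit D)) i ()
      : Matrix κ Unit D) = g * l * (of fun _ _ => c⁻¹ : Matrix Unit Unit D) := rfl
  have e2 : (of fun _ i => ((of fun _ _ => b⁻¹ : Matrix Unit Unit D) * r * g') () i
      : Matrix Unit κ D) = (of fun _ _ => b⁻¹ : Matrix Unit Unit D) * r * g' := rfl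
  have m (x y : D) : (of fun _ _ => x : Matrix Unit Unit D) * (of fun _ _ => y) =
      of fun _ _ => x * y := by ext; simp [mul_apply]
  have one : (of fun _ _ => 1 : Matrix Unit Unit D) = 1 := by ext; simp
  rw [e1, e2]
  simp only [fromBlocks_multiply, Matrix.mul_zero, Matrix.zero_mul, Matrix.one_mul, Matrix.mul_one,
      add_zero, zero_add, hg]
  congr 1
  · rw [m]
  · simp only [← Matrix.mul_assoc, m, mul_inv_cancel₀ hb, one, Matrix.one_mul]
  · simp only [Matrix.mul_assoc, m, inv_mul_cancel₀ hc, one, Matrix.mul_one]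
  · rw [add_comm]
    simp only [Matrix.mul_assoc]
    simp only [← Matrix.mul_assoc (of fun _ _ => c⁻¹ : Matrix Unit Unit D), m, _root_.mul_inv_rev]

theorem exists_isConj_lower_mul_upper
    (hD : ∀ x : D, ∃ a b c d : D, a ≠ 0 ∧ c ≠ 0 ∧ x = (a * b - b * a) * (c * d - d * c))
    {x : D} (hx0 : x ≠ 0) (hx1 : x ≠ 1) (N : ℕ) {ι : Type} [Fintype ι] [DecidableEq ι]
    (hN : Fintype.card ι = N) (S : Matrix ι ι D) (hS : ¬ ∃ a, S = diagonal fun _ => a)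
    {s t : D} (hs : s ≠ 0) (ht : t ≠ 0) :
    ∃ B C : Matrix ι ι D, IsConj S (B * C) ∧ IsLowerCommutator B s ∧ IsUpperCommutator C t := by
  induction N generalizing ι s t with
  | zero =>
    have := Fintype.card_eq_zero_iff.1 hN
    exact absurd ⟨0, Subsingleton.elim _ _⟩ hS
  | succ N ih =>
    obtain ⟨κ, _, _, e, k, r, A, hA⟩ := exists_isConj_submatrix_fromBlocks S hS (s * t)
    suffices H : ∃ B C : Matrix (Unit ⊕ κ) (Unit ⊕ κ) D,
        IsConj (S.submatrix e e) (B * C) ∧ IsLowerCommutator B s ∧ IsUpperCommutator C t by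
      obtain ⟨B, C, hBC, hB, hC⟩ := H
      refine ⟨_, _, ?_, hB.submatrix e.symm, hC.submatrix e.symm⟩
      rw [submatrix_mul_equiv]
      simpa using hBC.submatrix e.symm
    by_cases hS' : ∃ a, A - (of fun i _ => if i = k then 1 else 0 : Matrix κ Unit D) *
        (of fun _ _ => (s * t)⁻¹ : Matrix Unit Unit D) * r = diagonal fun _ => a
    · obtain ⟨a, ha⟩ := hS'
      obtain ⟨y₁, y₂, z₁, z₂, hy, hz, rfl⟩ := hD a
      -- Splitting the pivot as `(-s) * (-t)` cancels both defects, leaving scalar blocks that are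
      -- already commutators.
      obtain ⟨l', r', h⟩ := fromBlocks_isConj_mul (neg_ne_zero.2 hs) (neg_ne_zero.2 ht) r
        (of fun i _ => if i = k then 1 else 0) A (diagonal fun _ => y₁ * y₂ - y₂ * y₁)
        (diagonal fun _ => z₁ * z₂ - z₂ * z₁) (by
          rw [neg_mul_neg, ha, diagonal_mul_diagonal])
      rw [neg_mul_neg] at h
      exact ⟨_, _, hA.trans h, isLowerCommutator_fromBlocks_diagonal hy _ _ _,
        isUpperCommutator_fromBlocks_diagonal hz _ _ _⟩
    · have hcard : Fintype.card κ = N := by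
        have := Fintype.card_congr e
        simp at this; omega
      -- Inserting `x` into the split of `s * t` gives the remaining blocks defects `s * (1 - x⁻¹)`
      -- and `(1 - x) * t`, both nonzero.
      have hb : -s * x⁻¹ ≠ 0 := by simp [hs, hx0]
      have hc : -x * t ≠ 0 := by simp [ht, hx0]
      have hbc : -s * x⁻¹ * (-x * t) = s * t := by
        simp [mul_assoc, inv_mul_cancel_left₀ hx0]
      obtain ⟨B, C, hBC, hB, hC⟩ := ih hcard _ hS' (s := s + -s * x⁻¹) (t := t + -x * t)
        (by
          rw [show s + -s * x⁻¹ = s * (1 - x⁻¹) by noncomm_ring]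
          exact mul_ne_zero hs (sub_ne_zero.2 fun h => hx1 (by simpa using h.symm)))
        (by
          rw [show t + -x * t = (1 - x) * t by noncomm_ring]
          exact mul_ne_zero (sub_ne_zero.2 hx1.symm) ht)
      obtain ⟨l', r', h⟩ := fromBlocks_isConj_mul hb hc r
        (of fun i _ => if i = k then 1 else 0) A B C (by rwa [hbc])
      rw [hbc] at h
      exact ⟨_, _, hA.trans h, hB.fromBlocks _, hC.fromBlocks _⟩

/-- The case in which the compression of the matrix to the trailing block, after the leading entry
has been cleared, is scalar. -/
theorem isCommutatorProduct_fromBlocks_scalar (k : κ) {a b c d : D} (hc : c ≠ 0) (ρ : κ → D) :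
    IsCommutatorProduct (fromBlocks (0 : Matrix Unit Unit D)
      (of fun _ j => if j = k then -((a * b - b * a) * (c * d - d * c)) else 0)
      (of fun i _ => if i = k then 1 else 0)
      (of fun i j => if i = k then ρ j else
        if i = j then (a * b - b * a) * (c * d - d * c) else 0)) := by
  refine ⟨fromBlocks (0 : Matrix Unit Unit D)
      (of fun _ j => if j = k then (a * b - b * a) * (c * d - d * c) else 0)
      (of fun i _ => if i = k then 1 else 0)
      (diagonal fun i => if i = k then 0 else a * b - b * a),
    fromBlocks 1 (of fun _ j => ρ j) 0
      (diagonal fun i => if i = k then -1 else c * d - d * c), ?_, ?_, ?_⟩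
  · refine ⟨fromBlocks 1 0 0 (diagonal fun i => if i = k then 0 else a),
      fromBlocks 0 (of fun _ j => if j = k then (a * b - b * a) * (c * d - d * c) else 0)
        (of fun i _ => if i = k then -1 else 0) (diagonal fun i => if i = k then 0 else b), ?_⟩
    ext (i | i) (j | j)
    all_goals simp [fromBlocks_multiply, diagonal_apply, mul_apply]
    · by_cases hj : j = k <;> simp [hj]
    · by_cases hi : i = k <;> simp [hi]
    · by_cases hi : i = k <;> by_cases hj : j = k <;> by_cases hij : i = j <;> simp_all
  · refine ⟨fromBlocks 0 (of fun _ j => if j = k then 1 else 0) 0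
        (diagonal fun i => if i = k then 0 else c),
      fromBlocks 0 (of fun _ j => if j = k then 0 else - ρ j * c⁻¹)
        (of fun i _ => if i = k then 1 else 0)
        (diagonal fun i => if i = k then ρ k else d), ?_⟩
    ext (i | i) (j | j)
    all_goals simp [fromBlocks_multiply, diagonal_apply, mul_apply]
    · by_cases hj : j = k <;> simp [hj, hc]
    · by_cases hi : i = k <;> simp [hi]
    · by_cases hi : i = k <;> by_cases hj : j = k <;> by_cases hij : i = j <;> simp_all
  · ext (i | i) (j | j)
    all_goals simp [diagonal_apply, mul_apply]
    · by_cases hj : j = k <;> simp [hj]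
    · by_cases hi : i = k <;> by_cases hj : j = k <;> by_cases hij : i = j <;> simp_all

theorem isCommutatorProduct_diagonal (a b c d : D) :
    IsCommutatorProduct (diagonal fun _ : ι => (a * b - b * a) * (c * d - d * c)) :=
  ⟨_, _, ⟨diagonal fun _ => a, diagonal fun _ => b, rfl⟩,
    ⟨diagonal fun _ => c, diagonal fun _ => d, rfl⟩, by simp⟩

theorem isCommutatorProduct_of_not_scalar
    (hD : ∀ x : D, ∃ a b c d : D, a ≠ 0 ∧ c ≠ 0 ∧ x = (a * b - b * a) * (c * d - d * c))
    {x : D} (hx0 : x ≠ 0) (hx1 : x ≠ 1) {ι : Type} [Fintype ι] [DecidableEq ι]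
    (S : Matrix ι ι D) (hS : ¬ ∃ a, S = diagonal fun _ => a) : IsCommutatorProduct S := by
  obtain ⟨κ, _, _, e, k, r, A, hA⟩ := exists_isConj_submatrix_fromBlocks S hS 0
  suffices H : IsCommutatorProduct (S.submatrix e e) by
    simpa using H.submatrix e.symm
  refine .of_isConj hA ?_
  -- `T` is the Schur complement left after adding row `k` to the first row, which turns the leading
  -- entry `0` into the pivot `1 * 1`.
  let T : Matrix κ κ D := of fun i j => if i = k then -r () j else A i j
  by_cases hT : ∃ a, T = diagonal fun _ => a
  · obtain ⟨a, ha⟩ := hT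
    obtain ⟨y₁, y₂, z₁, z₂, hy, hz, rfl⟩ := hD a
    convert isCommutatorProduct_fromBlocks_scalar k hz (a := y₁) (b := y₂) (d := z₂)
      (fun j => A k j) using 2
    · rfl
    · ext i j
      have := congrFun (congrFun ha k) j
      simp only [T, of_apply, if_true, diagonal_apply, neg_eq_iff_eq_neg] at this
      rw [of_apply, show i = () from rfl, this]
      simp only [eq_comm (a := k)]
      split_ifs <;> simp
    · ext i j
      have := congrFun (congrFun ha i) j
      simp only [T, of_apply, diagonal_apply] at this ⊢
      by_cases hi : i = k
      · simp [hi]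
      · simpa [hi] using this
  · have hconj : IsConj (fromBlocks (of fun _ _ => 0) r (of fun i _ => if i = k then 1 else 0) A)
        (fromBlocks (of fun _ _ : Unit => (1 : D) * 1)
          (of fun _ j => r () j + A k j - if j = k then 1 else 0)
          (of fun i _ => if i = k then 1 else 0) (A - single k k 1)) := by
      refine IsConj.mul_left_conj (g := fromBlocks 1 (of fun _ j => if j = k then 1 else 0) 0 1)
        (g' := fromBlocks 1 (of fun _ j => if j = k then -1 else 0) 0 1) ?_ ?_ ?_
      · rw [fromBlocks_multiply, ← fromBlocks_one]
        congr 1 <;> simp [Matrix.mul_one, Matrix.one_mul]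
        ext i j
        by_cases hj : j = k <;> simp [hj]
      · rw [fromBlocks_multiply, ← fromBlocks_one]
        congr 1 <;> simp [Matrix.mul_one, Matrix.one_mul]
        ext i j
        by_cases hj : j = k <;> simp [hj]
      · ext (i | i) (j | j) <;> simp [fromBlocks_multiply, mul_apply, one_apply]
        · by_cases hj : j = k <;> simp [hj]; abel
        · by_cases hi : i = k <;> by_cases hj : j = k <;>
            simp [hi, hj, eq_comm (a := k)]; abel
    obtain ⟨B, C, hBC, hB, hC⟩ := exists_isConj_lower_mul_upper hD hx0 hx1 _ rfl T hT
      one_ne_zero one_ne_zero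
    obtain ⟨l', r', h⟩ := fromBlocks_isConj_mul (b := 1) (c := 1) one_ne_zero one_ne_zero
      (of fun _ j => r () j + A k j - if j = k then 1 else 0)
      (of fun i _ => if i = k then 1 else 0) (A - single k k 1) B C (by
        convert hBC using 1
        ext i j
        simp [T, mul_apply, single_apply]
        by_cases hi : i = k <;> by_cases hj : j = k <;> simp [hi, hj, eq_comm (a := k)])
    -- Both blocks have defect `1 = 0 + 1`, so the leading entries `1` bring the total defects to
    -- `0`.
    exact .of_isConj (hconj.trans h) ⟨_, _,
      (IsLowerCommutator.fromBlocks (s := 0) (by simpa using hB) _).isAdditiveCommutator,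
      (IsUpperCommutator.fromBlocks (s := 0) (by simpa using hC) _).isAdditiveCommutator, rfl⟩

end Blocks

theorem theorem3p8 {D : Type*} [DivisionRing D] (n : ℕ) (hn : 2 ≤ n)
    (hF : 3 ≤ ENat.card (Subring.center D) ∨ (ENat.card (Subring.center D) = 2 ∧ Odd n))
    (hD : ∀ x : D, x ≠ 0 →
      ∃ y z : D, IsNoncentralCommutator y ∧ IsNoncentralCommutator z ∧ x = y * z)
    (A : Matrix (Fin n) (Fin n) D) :
    ∃ B C : Matrix (Fin n) (Fin n) D,
      IsAdditiveCommutator B ∧ IsAdditiveCommutator C ∧ A = B * C := by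
  have hD' (x : D) : ∃ a b c d : D, a ≠ 0 ∧ c ≠ 0 ∧ x = (a * b - b * a) * (c * d - d * c) := by
    by_cases hx : x = 0
    · exact ⟨1, 0, 1, 0, one_ne_zero, one_ne_zero, by simp [hx]⟩
    · obtain ⟨y, z, ⟨⟨a, b, rfl⟩, -⟩, ⟨⟨c, d, rfl⟩, -⟩, rfl⟩ := hD x hx
      refine ⟨a, b, c, d, ?_, ?_, rfl⟩ <;> rintro rfl <;> simp at hx
  -- A noncentral factor of `1` differs from `0` and `1`, which are central.
  obtain ⟨x, -, ⟨-, hx⟩, -⟩ := hD 1 one_ne_zero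
  have hx0 : x ≠ 0 := fun h => hx (h ▸ zero_mem _)
  have hx1 : x ≠ 1 := fun h => hx (h ▸ one_mem _)
  by_cases hA : ∃ a, A = diagonal fun _ => a
  · obtain ⟨a, rfl⟩ := hA
    obtain ⟨a, b, c, d, -, -, rfl⟩ := hD' a
    exact isCommutatorProduct_diagonal a b c d
  · exact isCommutatorProduct_of_not_scalar hD' hx0 hx1 A hA
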